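/- Let $T$ be a complete first-order theory in a countable language, and suppose that $T$ is small, i.e. for every $n\ge 1$ the space $S_n(T)$ of complete $n$-types over $\emptyset$ is countable. Let $M$ be a model of $T$ (in particular, $M$ may be the monster model), let $n\in\mathbb N$, and let $D\subseteq M^n$ be a nonempty set that is definable without parameters. Then there is a Keisler measure $\mu$ over $M$, i.e. a finitely additive probability measure on the Boolean algebra of subsets of $M^n$ definable with parameters from $M$, such that $\mu(D)=1$ and $\mu(\sigma(X))=\mu(X)$ for every definable (with parameters from $M$) set $X\subseteq M^n$ and every automorphism $\sigma$ of $M$ whose graph is definable with parameters from $M$. -/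

import Mathlib

universe u v w x

open scoped FirstOrder

namespace FirstOrder.Language

open Set

/-- A theory is small if, for every `n ≥ 1`, its space of complete `n`-types over the empty set is
countable. -/
def Theory.IsSmall {L : Language.{u, v}} (T : L.Theory) : Prop :=
  ∀ n : ℕ, 1 ≤ n → Countable (T.CompleteType (Fin n))

section

variable {L : Language.{u, v}} {M : Type w} [L.Structure M] {α : Type x}

/-- The image of a set definable with parameters from `M` under an automorphism of `M` is
definable with parameters from `M`. -/
theorem definable_image_aut (σ : M ≃[L] M) {X : Set (α → M)}
    (hX : (univ : Set M).Definable L X) :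
    (univ : Set M).Definable L ((fun a : α → M => fun i => σ (a i)) '' X) := by
  rw [definable_iff_exists_formula_sum] at hX ⊢
  obtain ⟨φ, rfl⟩ := hX
  refine ⟨φ.relabel (Sum.map (fun a : (univ : Set M) => ⟨σ a, mem_univ _⟩) id), ?_⟩
  have key : ∀ a : α → M, φ.Realize (Sum.elim (fun b : (univ : Set M) => (b : M)) a) ↔
      φ.Realize (Sum.elim (fun b : (univ : Set M) => σ b) (fun i => σ (a i))) := by
    intro a
    rw [← StrongHomClass.realize_formula σ φ]
    have h : (σ ∘ Sum.elim (fun b : (univ : Set M) => (b : M)) a) =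
        Sum.elim (fun b : (univ : Set M) => σ b) (fun i => σ (a i)) := by
      funext i
      cases i <;> rfl
    rw [h]
  have key2 : ∀ v : α → M,
      (Sum.elim (fun b : (univ : Set M) => (b : M)) v) ∘
        (Sum.map (fun a : (univ : Set M) => (⟨σ a, mem_univ _⟩ : (univ : Set M))) id) =
      Sum.elim (fun b : (univ : Set M) => σ b) v := by
    intro v
    funext i
    cases i <;> rfl
  ext v
  simp only [mem_image, mem_ofPred_eq, Formula.realize_relabel, key2]
  constructor
  · rintro ⟨a, ha, rfl⟩
    exact (key a).1 ha
  · intro hv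
    refine ⟨fun i => σ.symm (v i), ?_, ?_⟩
    · rw [key]
      simpa using hv
    · funext i
      simp

/-- The action of an automorphism of `M` on the sets definable with parameters from `M`:
`X` is sent to `{(σ a₁, …, σ aₙ) | (a₁, …, aₙ) ∈ X}`. -/
def DefinableSet.image (σ : M ≃[L] M) (X : L.DefinableSet (univ : Set M) α) :
    L.DefinableSet (univ : Set M) α :=
  ⟨(fun a : α → M => fun i => σ (a i)) '' (X : Set (α → M)), definable_image_aut σ X.2⟩

/-- A set definable without parameters, seen as a set definable with parameters from `M`. -/
def DefinableSet.ofEmpty (D : L.DefinableSet (∅ : Set M) α) :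
    L.DefinableSet (univ : Set M) α :=
  ⟨(D : Set (α → M)), Set.Definable.mono D.2 (empty_subset _)⟩

/-- An automorphism of `M` is definable if its graph is definable with parameters from `M`. -/
def IsDefinableAut (σ : M ≃[L] M) : Prop :=
  (univ : Set M).Definable₂ L {p : M × M | p.2 = σ p.1}

variable (L M α) in
/-- A Keisler measure over `M` in the tuple of variables `α`: a finitely additive probability
measure on the Boolean algebra of subsets of `M^α` definable with parameters from `M`. It is a
global Keisler measure when `M` is the monster model. -/
structure KeislerMeasure where
  /-- The measure of a definable set. -/
  toFun : L.DefinableSet (univ : Set M) α → ℝ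
  nonneg' : ∀ X, 0 ≤ toFun X
  top' : toFun ⊤ = 1
  sup' : ∀ X Y, Disjoint X Y → toFun (X ⊔ Y) = toFun X + toFun Y

instance : CoeFun (KeislerMeasure L M α) (fun _ => L.DefinableSet (univ : Set M) α → ℝ) :=
  ⟨KeislerMeasure.toFun⟩

/-- `μ` is concentrated on `D` if `μ D = 1`. -/
def KeislerMeasure.ConcentratedOn (μ : KeislerMeasure L M α)
    (D : L.DefinableSet (univ : Set M) α) : Prop :=
  μ D = 1

/-- `μ` is invariant under the automorphism `σ`. -/
def KeislerMeasure.InvariantUnder (μ : KeislerMeasure L M α) (σ : M ≃[L] M) : Prop :=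
  ∀ X, μ (X.image σ) = μ X

end

end FirstOrder.Language

/-!
An automorphism `σ` of `M` whose graph is definable over a finite set `A` permutes the
`A`-definable subsets of `Mⁿ`, hence acts by homeomorphisms on the space `K` of complete `n`-types
over `A` containing the `∅`-definable set `D`. Smallness makes `K` countable: a type over a finite
tuple `a` in `n` variables is a section of a complete type over `∅` in finitely many variables.

A nonempty countable compact Hausdorff space has a nonempty finite subset stable under *all* its
self-homeomorphisms (`exists_finite_nonempty_homeomorph_invariant`): by the Baire category theorem
a minimal nonempty closed stable subset has an isolated point, by minimality it is the orbit of that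
point, and by compactness the orbit is finite. The uniform measure on such a finite subset of `K` is
a finitely additive measure on the `A`-definable sets, concentrated on `D` and invariant under every
`A`-definable automorphism (`exists_invariant_charge`).

An ultrafilter limit of these measures as `A` runs through the finite subsets of `M` is the required
Keisler measure, since each definable set and each definable automorphism is definable over some
finite set.

The type space `K` is encoded as the closure in `𝓑 → Bool`, with `𝓑` the collection of `A`-definable
sets, of the membership vectors of the points of `D`; it lies in a continuous image of the space of
complete types over `∅`, so no separate construction of types over `A` is needed.
-/

open Set Filter Topology

/-! ### Countable compact Hausdorff spaces -/

theorem exists_isOpen_singleton_of_countable (Y : Type*) [TopologicalSpace Y] [CompactSpace Y]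
    [T2Space Y] [Countable Y] [Nonempty Y] : ∃ y : Y, IsOpen ({y} : Set Y) := by
  obtain ⟨y, hy⟩ := nonempty_interior_of_iUnion_of_closed (f := fun y : Y => ({y} : Set Y))
    (fun _ => isClosed_singleton) (by ext; simp)
  refine ⟨y, ?_⟩
  rcases subset_singleton_iff_eq.1 (interior_subset (s := ({y} : Set Y))) with h | h
  · simp [h] at hy
  · exact interior_eq_iff_isOpen.1 h

theorem exists_finite_nonempty_homeomorph_invariant (K : Type*) [TopologicalSpace K]
    [CompactSpace K] [T2Space K] [Countable K] [Nonempty K] :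
    ∃ F : Set K, F.Finite ∧ F.Nonempty ∧ ∀ (h : K ≃ₜ K) (x : K), h x ∈ F ↔ x ∈ F := by
  let S : Set (Set K) := {C | IsClosed C ∧ C.Nonempty ∧ ∀ (h : K ≃ₜ K), ∀ x ∈ C, h x ∈ C}
  obtain ⟨Y, -, hY⟩ := zorn_superset_nonempty S (by
    intro c hcS hc hne
    refine ⟨⋂₀ c, ⟨isClosed_sInter fun t ht => (hcS ht).1, ?_, ?_⟩,
      fun s hs => sInter_subset_of_mem hs⟩
    · have := hne.to_subtype
      rw [sInter_eq_iInter]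
      refine IsCompact.nonempty_iInter_of_directed_nonempty_isCompact_isClosed _ ?_
        (fun i => (hcS i.2).2.1) (fun i => (hcS i.2).1.isCompact) (fun i => (hcS i.2).1)
      exact fun i j => (hc.total i.2 j.2).elim (fun hij => ⟨i, subset_rfl, hij⟩)
        fun hji => ⟨j, hji, subset_rfl⟩
    · exact fun h x hx t ht => (hcS ht).2.2 h x (hx t ht)) univ
    ⟨isClosed_univ, univ_nonempty, fun _ _ _ => mem_univ _⟩
  obtain ⟨⟨hYc, hYne, hYinv⟩, hYmin⟩ := hY
  have := hYne.to_subtype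
  have : CompactSpace Y := isCompact_iff_compactSpace.1 hYc.isCompact
  obtain ⟨⟨y, hy⟩, hopen⟩ := exists_isOpen_singleton_of_countable Y
  obtain ⟨U, hU, hUy⟩ := isOpen_induced_iff.1 hopen
  have hUY : ∀ x ∈ Y, x ∈ U ↔ x = y := fun x hx => by
    have := Set.ext_iff.1 hUy ⟨x, hx⟩
    simpa using this
  -- The points of `Y` outside the orbit of the isolated point form a smaller invariant closed set.
  have hcover : Y ⊆ ⋃ h : K ≃ₜ K, h ⁻¹' U := by
    by_contra hcon
    obtain ⟨x, hxY, hx⟩ := not_subset.1 hcon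
    have hmem : Y \ ⋃ h : K ≃ₜ K, h ⁻¹' U ∈ S := by
      refine ⟨hYc.sdiff (isOpen_iUnion fun h => hU.preimage h.continuous), ⟨x, hxY, hx⟩, ?_⟩
      rintro h z ⟨hzY, hz⟩
      refine ⟨hYinv h z hzY, fun hz' => hz ?_⟩
      obtain ⟨k, hk⟩ := mem_iUnion.1 hz'
      exact mem_iUnion.2 ⟨h.trans k, hk⟩
    have := hYmin hmem sdiff_subset hy
    exact this.2 (mem_iUnion.2 ⟨Homeomorph.refl K, (hUY y hy).2 rfl⟩)
  obtain ⟨t, ht⟩ := hYc.isCompact.elim_finite_subcover _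
    (fun h : K ≃ₜ K => hU.preimage h.continuous) hcover
  refine ⟨Y, (t.finite_toSet.image fun h : K ≃ₜ K => h.symm y).subset ?_, hYne, fun h x =>
    ⟨fun hx => ?_, hYinv h x⟩⟩
  · intro x hx
    obtain ⟨h, hh, hxh⟩ := mem_iUnion₂.1 (ht hx)
    exact ⟨h, hh, (h.symm_apply_eq).2 ((hUY _ (hYinv h x hx)).1 hxh).symm⟩
  · simpa using hYinv h.symm _ hx

/-! ### Invariant finitely additive measures -/

/-- The vector of truth values of `x ∈ X` for `X` in the collection `𝓑`. When `𝓑` is an algebra of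
sets, the closure of the range of this map in the cube `𝓑 → Bool` is the Stone space of `𝓑`. -/
noncomputable def membershipVector {Ω : Type*} (𝓑 : Set (Set Ω)) (x : Ω) : 𝓑 → Bool :=
  open Classical in fun X => decide (x ∈ (X : Set Ω))

/-- If the closure of the set of membership vectors of points of `D` is countable, then some
finitely additive measure concentrated on `D` is invariant under every permutation of `Ω` that
preserves `𝓑` and `D`: average over a finite set of points of the closure stable under all
homeomorphisms. -/
theorem exists_invariant_charge {Ω : Type*} (𝓑 : Set (Set Ω)) {D : Set Ω} (hD : D.Nonempty)
    (hK : (closure (membershipVector 𝓑 '' D)).Countable) :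
    ∃ ν : Set Ω → ℝ, (∀ X, ν X ∈ Icc (0 : ℝ) 1) ∧ (∀ X ∈ 𝓑, D ⊆ X → ν X = 1) ∧
      (∀ X ∈ 𝓑, ∀ Y ∈ 𝓑, X ∪ Y ∈ 𝓑 → Disjoint X Y → ν (X ∪ Y) = ν X + ν Y) ∧
      ∀ g : Ω ≃ Ω, g '' D = D → (∀ X, g '' X ∈ 𝓑 ↔ X ∈ 𝓑) → ∀ X ∈ 𝓑, ν (g '' X) = ν X := by
  classical
  set K := closure (membershipVector 𝓑 '' D) with hKdef
  have : Countable K := hK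
  have : Nonempty K := (hD.image _).closure.to_subtype
  have : CompactSpace K := isCompact_iff_compactSpace.1 isClosed_closure.isCompact
  obtain ⟨F', hF'fin, hF'ne, hF'⟩ := exists_finite_nonempty_homeomorph_invariant K
  -- `F` is the finite invariant set, regarded inside the whole cube.
  let F : Finset (𝓑 → Bool) := (hF'fin.image Subtype.val).toFinset
  have hF : ∀ f, f ∈ F ↔ ∃ h : f ∈ K, (⟨f, h⟩ : K) ∈ F' := fun f => by simp [F]
  have hFK : ∀ f ∈ F, f ∈ K := fun f hf => ((hF f).1 hf).1
  have hFpos : (0 : ℝ) < F.card := by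
    obtain ⟨f, hf⟩ := hF'ne
    exact Nat.cast_pos.2 (Finset.card_pos.2 ⟨f.1, (hF _).2 ⟨f.2, hf⟩⟩)
  let ev : Set Ω → (𝓑 → Bool) → ℝ := fun X f =>
    if h : X ∈ 𝓑 then (if f ⟨X, h⟩ then 1 else 0) else 0
  have hev : ∀ X f, ev X f ∈ Icc (0 : ℝ) 1 := fun X f => by
    simp only [ev]; split_ifs <;> simp
  refine ⟨fun X => (∑ f ∈ F, ev X f) / F.card, fun X => ⟨?_, ?_⟩, fun X hX hDX => ?_,
    fun X hX Y hY hXY hdisj => ?_, fun g hgD hg X hX => ?_⟩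
  · exact div_nonneg (Finset.sum_nonneg fun f _ => (hev X f).1) hFpos.le
  · rw [div_le_one hFpos]
    exact (Finset.sum_le_sum fun f _ => (hev X f).2).trans (by simp)
  · have key : ∀ f ∈ K, f ⟨X, hX⟩ = true := by
      refine closure_minimal (t := {f : 𝓑 → Bool | f ⟨X, hX⟩ = true}) ?_
        (isClosed_eq (continuous_apply _) continuous_const)
      rintro _ ⟨x, hx, rfl⟩
      simpa [membershipVector] using hDX hx
    simp only
    rw [div_eq_one_iff_eq hFpos.ne', Finset.sum_congr rfl
      (fun f hf => show ev X f = 1 by simp [ev, hX, key f (hFK f hf)])]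
    simp
  · have key : ∀ f ∈ K, ev (X ∪ Y) f = ev X f + ev Y f := by
      have hclosed : IsClosed ((fun f : 𝓑 → Bool =>
          (f ⟨X ∪ Y, hXY⟩, f ⟨X, hX⟩, f ⟨Y, hY⟩)) ⁻¹'
          {p | (if p.1 then (1 : ℝ) else 0) = (if p.2.1 then 1 else 0) + if p.2.2 then 1 else 0}) :=
        (isClosed_discrete _).preimage (by fun_prop)
      have := closure_minimal (s := membershipVector 𝓑 '' D) ?_ hclosed
      · intro f hf
        simpa [ev, hX, hY, hXY] using this hf
      · rintro _ ⟨x, hx, rfl⟩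
        have hx : x ∈ X → x ∉ Y := fun h => disjoint_left.1 hdisj h
        by_cases h1 : x ∈ X <;> by_cases h2 : x ∈ Y <;> simp_all [membershipVector]
    simp only
    rw [← add_div, ← Finset.sum_add_distrib, Finset.sum_congr rfl fun f hf => key f (hFK f hf)]
  -- `g` permutes `𝓑`, hence the coordinates of the cube, and the resulting homeomorphism `Φ`
  -- preserves `K`, hence `F`.
  · let e : 𝓑 ≃ 𝓑 :=
      { toFun := fun X => ⟨g '' X, (hg _).2 X.2⟩
        invFun := fun X => ⟨g.symm '' X, (hg _).1 (by simp [image_image])⟩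
        left_inv := fun X => by simp [image_image]
        right_inv := fun X => by simp [image_image] }
    let Φ : (𝓑 → Bool) ≃ₜ (𝓑 → Bool) :=
      { toFun := fun f => f ∘ e
        invFun := fun f => f ∘ e.symm
        left_inv := fun f => by ext; simp
        right_inv := fun f => by ext; simp
        continuous_toFun := by fun_prop
        continuous_invFun := by fun_prop }
    have hΦe : ∀ x, Φ (membershipVector 𝓑 x) = membershipVector 𝓑 (g.symm x) := fun x => by
      funext X
      simp [Φ, e, membershipVector, mem_image_equiv]
    have hΦK : Φ '' K = K := by
      rw [hKdef, Φ.image_closure, image_image]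
      simp only [hΦe]
      rw [← image_image (membershipVector 𝓑) g.symm D]
      nth_rw 1 [← hgD]
      simp [image_image]
    have hΦF : ∀ f, f ∈ F ↔ Φ f ∈ F := fun f => by
      have hmem : ∀ f, f ∈ K ↔ Φ f ∈ K := fun f => by
        conv_rhs => rw [← hΦK, Φ.injective.mem_set_image]
      rw [hF, hF]
      constructor
      · rintro ⟨h1, h2⟩
        exact ⟨(hmem f).1 h1, (hF' (Φ.subtype hmem) ⟨f, h1⟩).2 h2⟩
      · rintro ⟨h1, h2⟩
        exact ⟨(hmem f).2 h1, (hF' (Φ.subtype hmem) ⟨f, (hmem f).2 h1⟩).1 h2⟩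
    refine congrArg (· / (F.card : ℝ)) ?_
    refine Finset.sum_equiv Φ.toEquiv hΦF fun f _ => ?_
    simp [ev, hX, (hg X).2 hX, Φ, e]

namespace FirstOrder.Language

open Theory

variable {L : Language.{u, v}} {M : Type w} [L.Structure M]

/-! ### Definable sets over a finite set of parameters -/

/-- In a small theory there are only countably many complete types over a finite set `A`. -/
theorem countable_closure_membershipVector {T : L.Theory} (hsmall : T.IsSmall) [Nonempty M]
    (hM : M ⊨ T) {n : ℕ} {A : Set M} (hA : A.Finite) (hA' : A.Nonempty) (D : Set (Fin n → M)) :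
    (closure (membershipVector {X : Set (Fin n → M) | A.Definable L X} '' D)).Countable := by
  classical
  have := hA.fintype
  have := hA'.to_subtype
  let k := Fintype.card (A ⊕ Fin n)
  let e : A ⊕ Fin n ≃ Fin k := Fintype.equivFin _
  -- Nonemptiness of `A` is used here: smallness says nothing about types in no variables.
  have hk : 1 ≤ k := Fintype.card_pos
  have := hsmall k hk
  have hex : ∀ X : {X : Set (Fin n → M) | A.Definable L X}, ∃ φ : L.Formula (Fin k),
      ∀ x : Fin n → M, φ.Realize (Sum.elim (↑) x ∘ e.symm) ↔ x ∈ (X : Set (Fin n → M)) := by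
    rintro ⟨X, hX⟩
    obtain ⟨φ, rfl⟩ := definable_iff_exists_formula_sum.1 hX
    refine ⟨φ.relabel e, fun x => ?_⟩
    simp [Formula.realize_relabel, Function.comp_assoc]
  choose φ hφ using hex
  -- A complete type over `∅` in the variables `A ⊕ Fin n` decides all `A`-definable sets. The range
  -- of `Θ` is compact and contains all membership vectors, hence it contains their closure.
  let Θ : T.CompleteType (Fin k) → ({X : Set (Fin n → M) | A.Definable L X} → Bool) :=
    fun p X => (T.typesWith (Formula.equivSentence (φ X))).boolIndicator p
  have hΘ : Continuous Θ := by
    refine continuous_pi fun X => ?_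
    exact (continuous_boolIndicator_iff_isClopen _).2 (CompleteType.isClopen_typesWith _)
  refine (countable_range Θ).mono (closure_minimal ?_ (isCompact_range hΘ).isClosed)
  rintro _ ⟨x, -, rfl⟩
  refine ⟨T.typeOf (Sum.elim (↑) x ∘ e.symm), ?_⟩
  funext X
  simp [Θ, membershipVector, Set.boolIndicator, CompleteType.mem_typesWith_iff, hφ]

theorem definableMap_of_graph {α : Type*} {A : Set M} {f : M → M}
    (hf : A.Definable₂ L {p : M × M | p.2 = f p.1}) :
    A.DefinableMap L (fun (a : α → M) i => f (a i)) := by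
  intro i
  have h := Definable.preimage_comp (![some i, none] : Fin 2 → Option α) hf
  refine (congrArg (A.Definable L) (Set.ext fun w => ?_)).mp h
  simp [Function.tupleGraph, eq_comm]

/-- An `A`-definable permutation of `M` permutes the `A`-definable sets. -/
theorem definable_image_iff {α : Type*} [Finite α] {A : Set M} (σ : M ≃ M)
    (hσ : A.Definable₂ L {p : M × M | p.2 = σ p.1}) (X : Set (α → M)) :
    A.Definable L ((fun (a : α → M) i => σ (a i)) '' X) ↔ A.Definable L X := by
  have hσ' : A.Definable₂ L {p : M × M | p.2 = σ.symm p.1} := by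
    have h := Definable.preimage_comp (![1, 0] : Fin 2 → Fin 2) hσ
    refine (congrArg (A.Definable L) (Set.ext fun w => ?_)).mp h
    simp [Equiv.eq_symm_apply, eq_comm]
  constructor
  · intro h
    convert! Definable.preimage_map (definableMap_of_graph hσ) h using 1
    exact (preimage_image_eq _ (fun a b hab => by
      funext i; exact σ.injective (congrFun hab i))).symm
  · intro h
    convert! Definable.preimage_map (definableMap_of_graph hσ') h using 1
    exact congrFun (image_eq_preimage_of_inverse (f := fun (a : α → M) i => σ (a i))
      (g := fun a i => σ.symm (a i))
      (fun a => funext fun i => by simp) (fun a => funext fun i => by simp)) X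

theorem image_eq_of_definable_empty {α : Type*} (σ : M ≃[L] M) {D : Set (α → M)}
    (hD : (∅ : Set M).Definable L D) : (fun (a : α → M) i => σ (a i)) '' D = D := by
  obtain ⟨φ, rfl⟩ := empty_definable_iff.1 hD
  ext a
  constructor
  · rintro ⟨b, hb, rfl⟩
    exact (StrongHomClass.realize_formula σ φ).2 hb
  · intro ha
    refine ⟨fun i => σ.symm (a i), ?_, by simp⟩
    exact (StrongHomClass.realize_formula σ.symm φ).2 ha

end FirstOrder.Language

/-! ### The limit over finite sets of parameters -/

open FirstOrder FirstOrder.Language in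
theorem corollary4p16 {L : FirstOrder.Language.{u, v}} (hL : Countable L.Symbols)
    (T : L.Theory) (hT : T.IsComplete) (hsmall : T.IsSmall)
    (M : Type w) [L.Structure M] [Nonempty M] (hM : M ⊨ T)
    (n : ℕ) (D : L.DefinableSet (∅ : Set M) (Fin n)) (hD : (D : Set (Fin n → M)).Nonempty) :
    ∃ μ : FirstOrder.Language.KeislerMeasure L M (Fin n),
      μ.ConcentratedOn D.ofEmpty ∧
        ∀ σ : M ≃[L] M, FirstOrder.Language.IsDefinableAut σ → μ.InvariantUnder σ := by
  classical
  let act (σ : M ≃[L] M) : (Fin n → M) ≃ (Fin n → M) := Equiv.piCongrRight fun _ => σ.toEquiv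
  have hcharge : ∀ A : Finset M, ∃ ν : Set (Fin n → M) → ℝ, (∀ X, ν X ∈ Icc (0 : ℝ) 1) ∧
      ((A : Set M).Nonempty →
      (∀ X, (A : Set M).Definable L X → (D : Set (Fin n → M)) ⊆ X → ν X = 1) ∧
      (∀ X Y, (A : Set M).Definable L X → (A : Set M).Definable L Y → Disjoint X Y →
        ν (X ∪ Y) = ν X + ν Y) ∧
      ∀ σ : M ≃[L] M, (A : Set M).Definable₂ L {p : M × M | p.2 = σ p.1} →
        ∀ X, (A : Set M).Definable L X → ν ((fun (a : Fin n → M) i => σ (a i)) '' X) = ν X) := by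
    intro A
    by_cases hA : (A : Set M).Nonempty
    · obtain ⟨ν, h1, h2, h3, h4⟩ := exists_invariant_charge {X | (A : Set M).Definable L X} hD
        (countable_closure_membershipVector hsmall hM A.finite_toSet hA _)
      refine ⟨ν, h1, fun _ => ⟨h2, fun X Y hX hY => h3 X hX Y hY (hX.union hY),
        fun σ hσ X hX => ?_⟩⟩
      exact h4 (act σ) (image_eq_of_definable_empty σ D.2)
        (fun Z => definable_image_iff σ.toEquiv hσ Z) X hX
    · exact ⟨0, by simp, fun h => absurd h hA⟩
  choose ν hν01 hν using hcharge
  let 𝒰 : Ultrafilter (Finset M) := Ultrafilter.of atTop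
  have h𝒰 : (𝒰 : Filter (Finset M)) ≤ atTop := Ultrafilter.of_le _
  have hlim : ∀ X : Set (Fin n → M), ∃ r ∈ Icc (0 : ℝ) 1, Tendsto (fun A => ν A X) 𝒰 (𝓝 r) :=
    fun X => isCompact_Icc.ultrafilter_le_nhds' (𝒰.map fun A => ν A X)
      (Filter.Eventually.of_forall (f := (𝒰 : Filter (Finset M))) fun A => hν01 A X)
  choose m hm01 hm using hlim
  have hne : ∀ᶠ A : Finset M in (𝒰 : Filter (Finset M)), (A : Set M).Nonempty := by
    obtain ⟨a⟩ := ‹Nonempty M›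
    filter_upwards [h𝒰 (eventually_ge_atTop {a})] with A hA
    exact ⟨a, by simpa using hA⟩
  have hdef : ∀ {α : Type} {X : Set (α → M)}, (univ : Set M).Definable L X →
      ∀ᶠ A : Finset M in (𝒰 : Filter (Finset M)), (A : Set M).Definable L X := by
    intro α X hX
    obtain ⟨A₀, -, hA₀⟩ := definable_iff_finitely_definable.1 hX
    filter_upwards [h𝒰 (eventually_ge_atTop A₀)] with A hA
    exact hA₀.mono (by exact_mod_cast hA)
  have hone : ∀ X : L.DefinableSet (univ : Set M) (Fin n), (D : Set (Fin n → M)) ⊆ X →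
      m X = 1 := by
    intro X hDX
    refine tendsto_nhds_unique_of_eventuallyEq (hm X) tendsto_const_nhds ?_
    filter_upwards [hne, hdef X.2] with A hA hX
    exact (hν A hA).1 X hX hDX
  refine ⟨⟨fun X => m X, fun X => (hm01 X).1, hone ⊤ (subset_univ _), fun X Y hXY => ?_⟩,
    hone _ subset_rfl, fun σ hσ X => ?_⟩
  · have hdisj : Disjoint (X : Set (Fin n → M)) (Y : Set (Fin n → M)) := by
      rw [disjoint_iff] at hXY ⊢
      exact congrArg SetLike.coe hXY
    refine tendsto_nhds_unique_of_eventuallyEq (hm (X ∪ Y)) ((hm X).add (hm Y)) ?_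
    filter_upwards [hne, hdef X.2, hdef Y.2] with A hA hX hY
    exact (hν A hA).2.1 X Y hX hY hdisj
  · refine tendsto_nhds_unique_of_eventuallyEq (hm _) (hm X) ?_
    filter_upwards [hne, hdef X.2, hdef hσ] with A hA hX hσA
    exact (hν A hA).2.2 σ hσA X hX
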